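/- Let $P>0$ and $N\in\mathbb{N}$. Let $(K_n)$, $(S_n)$ be sequences of integers with $0<S_n<K_n$, $K_n\to\infty$ and $q_n:=S_n/K_n\to p$ for some $p\in(0,1)$ (for instance $q_n=q\in(0,1)$ fixed and $S_n=qK_n$). For each $n$ let $\mathbf m_n\in\mathbb{C}^N$ be a vector with $\|\mathbf m_n\|=1$, and let $\mathbf h_{n,1},\dots,\mathbf h_{n,K_n}$ be i.i.d. random vectors with the circularly symmetric complex Gaussian law $\mathcal{CN}(\mathbf 0,\mathbf I)$ on $\mathbb{C}^N$. Put $$Y_{n,k}=\frac{1}{P\,|\mathbf m_n^{\mathrm H}\mathbf h_{n,k}|^2},\qquad X_n=\min_{\mathcal S\subseteq\{1,\dots,K_n\},\ |\mathcal S|=S_n}\ \max_{k\in\mathcal S}Y_{n,k}.$$ Let $F(y)=e^{-1/(Py)}$ and $f(y)=\frac{1}{Py^2}e^{-1/(Py)}$ for $y>0$, $F(y)=f(y)=0$ for $y\le 0$, and $F^{-1}(q)=-\frac{1}{P\ln q}$ for $q\in(0,1)$. Then $F$ is the cumulative distribution function and $f$ the probability density of every $Y_{n,k}$, the function $F$ maps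 $(0,\infty)$ bijectively onto $(0,1)$ with inverse $F^{-1}$, and, as $n\to\infty$, $$\sqrt{K_n}\,f\bigl(F^{-1}(q_n)\bigr)\,\frac{X_n-F^{-1}(q_n)}{\sqrt{q_n(1-q_n)}}\ \xrightarrow{\ d\ }\ \mathcal N(0,1).$$ -/

import Mathlib

open MeasureTheory ProbabilityTheory Filter Topology

noncomputable section

/-- The circularly symmetric complex Gaussian law `CN(0, 1)`: independent real and imaginary
parts, each centred Gaussian with variance `1 / 2`. -/
def complexGaussian : Measure ℂ :=
  ((gaussianReal 0 (1 / 2)).prod (gaussianReal 0 (1 / 2))).map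
    (fun p : ℝ × ℝ => (⟨p.1, p.2⟩ : ℂ))

/-- The law `CN(0, I)` on `ℂ^N`: the coordinates are independent with law `CN(0, 1)`. -/
def complexGaussianVec (N : ℕ) : Measure (EuclideanSpace ℂ (Fin N)) :=
  (Measure.pi (fun _ : Fin N => complexGaussian)).map (WithLp.toLp 2)

/-- The quantity `1 / (P |mᴴ h|²)` of a device with channel `h`, for the aggregate beamforming
vector `m` and the maximum power `P`. (`inner ℂ m h` is `mᴴ h = ∑ i, conj (m i) * h i`.) -/
def deviceCost {N : ℕ} (P : ℝ) (m h : EuclideanSpace ℂ (Fin N)) : ℝ :=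
  (P * ‖inner ℂ m h‖ ^ 2)⁻¹

/-- The minimum, over the sets `A` of exactly `S` of the `K` devices, of the largest of the
values `y k`, `k ∈ A` (used for `0 < S ≤ K`, where all sets involved are finite and nonempty). -/
def minMaxCost {K : ℕ} (S : ℕ) (y : Fin K → ℝ) : ℝ :=
  ⨅ A : {A : Finset (Fin K) // A.card = S}, ⨆ k : {k : Fin K // k ∈ A.1}, y k.1

/-- The function `F(y) = exp(-1 / (P y))` for `y > 0`, and `0` for `y ≤ 0`. -/
def costCDF (P y : ℝ) : ℝ := if 0 < y then Real.exp (-(P * y)⁻¹) else 0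

/-- The function `f(y) = (P y²)⁻¹ exp(-1 / (P y))` for `y > 0`, and `0` for `y ≤ 0`. -/
def costPDF (P y : ℝ) : ℝ := if 0 < y then (P * y ^ 2)⁻¹ * Real.exp (-(P * y)⁻¹) else 0

/-- The function `F⁻¹(q) = -1 / (P ln q)`. -/
def costQuantile (P q : ℝ) : ℝ := -1 / (P * Real.log q)

end

/-! `X_n` is the `S_n`-th order statistic, so `X_n ≤ x` says that at least `S_n` of the costs are `≤
x` (`minMaxCost_le_iff`). At `x_n = F⁻¹(q_n) + t √(q_n(1-q_n)) / (√K_n f(F⁻¹(q_n)))`, the count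
`B_n` of such costs is binomial with success probability `a_n = F(x_n)`, and the event reads `(B_n -
K_n a_n)/√K_n + √K_n (a_n - q_n) ≥ 0`. The drift tends to `t √(p(1-p))` by differentiating `F`
(`tendsto_costThreshold`). The fluctuation tends to `N(0, p(1-p))`; since `a_n` varies with `n`,
this is a triangular-array limit theorem, proved with characteristic functions
(`tendsto_measure_le_card`). The limiting probability is the standard normal distribution function
at `t` (`gaussianReal_Ici_zero`). The formula for `F` holds because `mᴴh` is again `CN(0, 1)` for a
unit vector `m`, so `|mᴴh|²` is exponential with mean 1. -/

/-! ### Complex Gaussian laws and the effective channel gain -/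

lemma measurable_complex_mk : Measurable (fun p : ℝ × ℝ => (⟨p.1, p.2⟩ : ℂ)) :=
  Complex.measurableEquivRealProd.symm.measurable

instance : IsProbabilityMeasure complexGaussian :=
  Measure.isProbabilityMeasure_map measurable_complex_mk.aemeasurable

lemma charFun_complexGaussian (t : ℂ) :
    charFun complexGaussian t = Complex.exp (-(‖t‖ ^ 2 : ℝ) / 4) := by
  have h1 : charFun complexGaussian t =
      charFun (gaussianReal 0 (1 / 2)) t.re * charFun (gaussianReal 0 (1 / 2)) t.im := by
    rw [charFun_apply, complexGaussian, integral_map measurable_complex_mk.aemeasurable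
      (by fun_prop), charFun_apply, charFun_apply, ← integral_prod_mul]
    refine integral_congr_ae (ae_of_all _ fun p => ?_)
    simp only [← Complex.exp_add]
    congr 1
    simp [Complex.inner]
    ring
  rw [h1, charFun_gaussianReal, charFun_gaussianReal, ← Complex.exp_add]
  congr 1
  rw [Complex.sq_norm, Complex.normSq_apply]
  push_cast
  simp
  ring

/-- The characteristic function of `CN(0, 1)` depends only on `‖t‖²`, and the norms `‖m i * t‖²` add
up to `‖t‖²` for a unit vector. -/
lemma map_inner_complexGaussianVec {N : ℕ} (m : EuclideanSpace ℂ (Fin N)) (hm : ‖m‖ = 1) :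
    (complexGaussianVec N).map (fun h => inner ℂ m h) = complexGaussian := by
  have hmeas : Measurable (WithLp.toLp 2 : (Fin N → ℂ) → EuclideanSpace ℂ (Fin N)) := by fun_prop
  have : IsProbabilityMeasure (complexGaussianVec N) :=
    Measure.isProbabilityMeasure_map hmeas.aemeasurable
  have : IsProbabilityMeasure ((complexGaussianVec N).map (fun h => inner ℂ m h)) :=
    Measure.isProbabilityMeasure_map (by fun_prop)
  refine Measure.ext_of_charFun (funext fun t => ?_)
  have h1 : charFun ((complexGaussianVec N).map (fun h => inner ℂ m h)) t =
      charFun ((Measure.pi (fun _ : Fin N => complexGaussian)).map (WithLp.toLp 2))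
        (WithLp.toLp 2 (fun i => m i * t)) := by
    rw [charFun_apply, integral_map (by fun_prop) (by fun_prop), charFun_apply]
    refine integral_congr_ae (ae_of_all _ fun x => ?_)
    -- The real adjoint of `x ↦ mᴴx` sends `t` to the vector with entries `m i * t`.
    have : inner ℝ (inner ℂ m x) t = inner ℝ x (WithLp.toLp 2 (fun i => m i * t)) := by
      simp only [PiLp.inner_apply, Complex.inner, ← Complex.re_sum]
      congr 1
      rw [map_sum, Finset.mul_sum]
      refine Finset.sum_congr rfl fun i _ => ?_
      simp
      ring
    simp only [this]
  rw [h1, charFun_pi, charFun_complexGaussian]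
  simp only [charFun_complexGaussian]
  rw [← Complex.exp_sum, ← Finset.sum_div, Finset.sum_neg_distrib, ← Complex.ofReal_sum]
  congr 4
  simp only [norm_mul, mul_pow]
  rw [← Finset.sum_mul, ← EuclideanSpace.norm_sq_eq, hm]
  simp

/-- In polar coordinates the joint density is `ρ exp(-ρ²)/π`, which has an elementary antiderivative
in `ρ`; the angle contributes `2π`. -/
lemma complexGaussian_tail {r : ℝ} (hr : 0 ≤ r) :
    complexGaussian {z | r ≤ ‖z‖ ^ 2} = ENNReal.ofReal (Real.exp (-r)) := by
  have hset : MeasurableSet {z : ℂ | r ≤ ‖z‖ ^ 2} := measurableSet_le (by fun_prop) (by fun_prop)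
  rw [complexGaussian, Measure.map_apply measurable_complex_mk hset,
    gaussianReal_of_var_ne_zero _ (by simp), prod_withDensity (by fun_prop) (by fun_prop),
    withDensity_apply _ (measurable_complex_mk hset), ← lintegral_indicator
      (measurable_complex_mk hset), ← Measure.volume_eq_prod, ← lintegral_comp_polarCoord_symm]
  have h1 : ∀ p ∈ polarCoord.target, ENNReal.ofReal p.1 •
      ((fun p : ℝ × ℝ => (⟨p.1, p.2⟩ : ℂ)) ⁻¹' {z : ℂ | r ≤ ‖z‖ ^ 2}).indicator
        (fun p => gaussianPDF 0 (1 / 2) p.1 * gaussianPDF 0 (1 / 2) p.2) (polarCoord.symm p) =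
      (Set.Ici (√r)).indicator (fun ρ => ENNReal.ofReal (ρ * Real.exp (-ρ ^ 2) / Real.pi)) p.1
        * 1 := by
    rintro ⟨ρ, θ⟩ hp
    have hρ : 0 < ρ := hp.1
    have hn : ‖(⟨ρ * Real.cos θ, ρ * Real.sin θ⟩ : ℂ)‖ ^ 2 = ρ ^ 2 := by
      rw [Complex.sq_norm, Complex.normSq_apply]
      nlinarith [Real.sin_sq_add_cos_sq θ]
    have hiff : r ≤ ρ ^ 2 ↔ √r ≤ ρ := (Real.sqrt_le_left hρ.le).symm
    have hmem : polarCoord.symm (ρ, θ) ∈ (fun p : ℝ × ℝ => (⟨p.1, p.2⟩ : ℂ)) ⁻¹'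
        {z : ℂ | r ≤ ‖z‖ ^ 2} ↔ √r ≤ ρ := by
      rw [← hiff, ← hn]
      rfl
    by_cases hc : √r ≤ ρ
    · rw [Set.indicator_of_mem (hmem.2 hc), Set.indicator_of_mem (Set.mem_Ici.2 hc), mul_one,
        polarCoord_symm_apply]
      change ENNReal.ofReal ρ * (ENNReal.ofReal (gaussianPDFReal 0 (1 / 2) (ρ * Real.cos θ)) *
        ENNReal.ofReal (gaussianPDFReal 0 (1 / 2) (ρ * Real.sin θ))) = _
      rw [← ENNReal.ofReal_mul (gaussianPDFReal_nonneg _ _ _), ← ENNReal.ofReal_mul hρ.le]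
      congr 1
      simp only [gaussianPDFReal]
      have hc2 : (√(2 * Real.pi * ((1 / 2 : NNReal) : ℝ)))⁻¹ ^ 2 = Real.pi⁻¹ := by
        rw [inv_pow, Real.sq_sqrt (by positivity)]
        congr 1
        push_cast
        ring
      have hexp : Real.exp (-(ρ * Real.cos θ - 0) ^ 2 / (2 * ((1 / 2 : NNReal) : ℝ))) *
          Real.exp (-(ρ * Real.sin θ - 0) ^ 2 / (2 * ((1 / 2 : NNReal) : ℝ))) =
          Real.exp (-ρ ^ 2) := by
        rw [← Real.exp_add]
        congr 1
        simp
        nlinarith [Real.sin_sq_add_cos_sq θ]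
      rw [div_eq_mul_inv (ρ * Real.exp (-ρ ^ 2)), ← hc2, ← hexp]
      ring
    · rw [Set.indicator_of_notMem (hmem.not.2 hc), Set.indicator_of_notMem (by simpa using hc)]
      simp
  rw [setLIntegral_congr_fun polarCoord.open_target.measurableSet h1, polarCoord_target,
    Measure.volume_eq_prod, ← Measure.prod_restrict, lintegral_prod_mul (g := fun _ => 1) (by
      refine Measurable.aemeasurable (Measurable.indicator (by fun_prop) measurableSet_Ici)) (by fun_prop)]
  rw [lintegral_indicator measurableSet_Ici, Measure.restrict_restrict measurableSet_Ici]
  have hI : (Set.Ici (√r) ∩ Set.Ioi 0 : Set ℝ) =ᵐ[volume] Set.Ioi (√r) := by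
    refine Filter.EventuallyEq.trans (Filter.EventuallyEq.inter (Ioi_ae_eq_Ici (a := √r)).symm
      (ae_eq_refl _)) ?_
    rw [Set.Ioi_inter_Ioi, sup_eq_left.2 (Real.sqrt_nonneg _)]
    rfl
  rw [Measure.restrict_congr_set hI]
  have hd : ∀ x ∈ Set.Ici (√r), HasDerivAt (fun ρ => -Real.exp (-ρ ^ 2) / (2 * Real.pi))
      (x * Real.exp (-x ^ 2) / Real.pi) x := by
    intro x _
    have := ((((hasDerivAt_id x).pow 2).neg.exp).neg).div_const (2 * Real.pi)
    convert! this using 1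
    simp
    field_simp
  have hnn : ∀ x ∈ Set.Ioi (√r), 0 ≤ x * Real.exp (-x ^ 2) / Real.pi := by
    intro x hx
    have : 0 < x := (Real.sqrt_nonneg r).trans_lt hx
    positivity
  have hlim : Tendsto (fun ρ : ℝ => -Real.exp (-ρ ^ 2) / (2 * Real.pi)) atTop (𝓝 0) := by
    have : Tendsto (fun ρ : ℝ => Real.exp (-ρ ^ 2)) atTop (𝓝 0) :=
      Real.tendsto_exp_neg_atTop_nhds_zero.comp (tendsto_pow_atTop (by norm_num))
    simpa using this.neg.div_const (2 * Real.pi)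
  rw [← ofReal_integral_eq_lintegral_ofReal
    (integrableOn_Ioi_deriv_of_nonneg' hd hnn hlim)
    ((ae_restrict_iff' measurableSet_Ioi).2 (ae_of_all _ hnn)),
    integral_Ioi_of_hasDerivAt_of_nonneg' hd hnn hlim]
  simp only [lintegral_one, Measure.restrict_apply_univ, Real.volume_Ioo]
  rw [← ENNReal.ofReal_mul (by rw [zero_sub, neg_div, neg_neg]; positivity), Real.sq_sqrt hr]
  congr 1
  field_simp
  ring

/-! ### Distribution function and density of a cost -/

lemma costCDF_nonneg (P y : ℝ) : 0 ≤ costCDF P y := by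
  unfold costCDF; split_ifs <;> positivity

lemma costPDF_nonneg {P : ℝ} (hP : 0 < P) (y : ℝ) : 0 ≤ costPDF P y := by
  unfold costPDF; split_ifs <;> positivity

lemma measurable_deviceCost {N : ℕ} (P : ℝ) (m : EuclideanSpace ℂ (Fin N)) :
    Measurable (deviceCost P m) := by
  unfold deviceCost; fun_prop

lemma measure_deviceCost_le {N : ℕ} {P : ℝ} (hP : 0 < P) {m : EuclideanSpace ℂ (Fin N)}
    (hm : ‖m‖ = 1) (y : ℝ) :
    complexGaussianVec N {h | deviceCost P m h ≤ y} = ENNReal.ofReal (costCDF P y) := by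
  have hmap : ∀ s : Set ℂ, MeasurableSet s →
      complexGaussianVec N {h | inner ℂ m h ∈ s} = complexGaussian s := by
    intro s hs
    rw [← map_inner_complexGaussianVec m hm, Measure.map_apply (by fun_prop) hs]
    rfl
  -- As `0⁻¹ = 0`, a vanishing gain gives cost `0` instead of `∞`; this event must be shown to be
  -- null.
  have hzero : complexGaussian {0} = 0 := by
    have h := complexGaussian_tail (r := 0) le_rfl
    have hlim : Tendsto (fun r : ℝ => ENNReal.ofReal (1 - Real.exp (-r))) (𝓝[>] 0) (𝓝 0) := by
      have : Tendsto (fun r : ℝ => ENNReal.ofReal (1 - Real.exp (-r))) (𝓝 0)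
          (𝓝 (ENNReal.ofReal (1 - Real.exp (-0)))) :=
        (ENNReal.continuous_ofReal.comp (by fun_prop)).tendsto _
      simpa using this.mono_left nhdsWithin_le_nhds
    refine le_antisymm (ge_of_tendsto hlim ?_) zero_le
    filter_upwards [self_mem_nhdsWithin] with r hr
    have hr : 0 < r := hr
    have hset : MeasurableSet {z : ℂ | r ≤ ‖z‖ ^ 2} := measurableSet_le (by fun_prop) (by fun_prop)
    calc complexGaussian {0} ≤ complexGaussian {z | r ≤ ‖z‖ ^ 2}ᶜ :=
          measure_mono (by rintro z rfl; simpa using hr)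
      _ = _ := by
        rw [prob_compl_eq_one_sub hset, complexGaussian_tail hr.le,
          ENNReal.ofReal_sub _ (Real.exp_pos _).le, ENNReal.ofReal_one]
  rcases lt_trichotomy y 0 with hy | rfl | hy
  · have : {h | deviceCost P m h ≤ y} = ∅ := by
      ext h
      simp only [Set.mem_ofPred_eq, Set.mem_empty_iff_false, iff_false, not_le, deviceCost]
      exact hy.trans_le (by positivity)
    rw [this, costCDF, if_neg hy.not_gt]
    simp
  · have : {h | deviceCost P m h ≤ 0} = {h | inner ℂ m h ∈ ({0} : Set ℂ)} := by
      ext h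
      simp only [Set.mem_ofPred_eq, Set.mem_singleton_iff, deviceCost, inv_nonpos]
      constructor
      · intro h1
        by_contra h2
        have : 0 < ‖inner ℂ m h‖ := norm_pos_iff.2 h2
        have : 0 < P * ‖inner ℂ m h‖ ^ 2 := by positivity
        linarith
      · intro h1; simp [h1]
    rw [this, hmap _ (measurableSet_singleton _), hzero, costCDF, if_neg (lt_irrefl _)]
    simp
  · have : {h | deviceCost P m h ≤ y} =
        {h | inner ℂ m h ∈ ({0} ∪ {z : ℂ | (P * y)⁻¹ ≤ ‖z‖ ^ 2})} := by
      ext h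
      simp only [Set.mem_ofPred_eq, Set.mem_union, Set.mem_singleton_iff, deviceCost]
      rcases eq_or_ne (inner ℂ m h) 0 with h0 | h0
      · simp [h0, hy.le]
      · have : 0 < ‖inner ℂ m h‖ := norm_pos_iff.2 h0
        simp only [h0, false_or]
        rw [inv_le_comm₀ (by positivity) hy, inv_le_iff_one_le_mul₀ (by positivity),
          inv_le_iff_one_le_mul₀ (by positivity)]
        constructor <;> intro h <;> linarith
    have hset : MeasurableSet {z : ℂ | (P * y)⁻¹ ≤ ‖z‖ ^ 2} :=
      measurableSet_le (by fun_prop) (by fun_prop)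
    rw [this, hmap _ ((measurableSet_singleton _).union hset), costCDF, if_pos hy,
      ← complexGaussian_tail (by positivity)]
    refine le_antisymm ((measure_union_le _ _).trans (by rw [hzero, zero_add]))
      (measure_mono Set.subset_union_right)

lemma hasStrictDerivAt_exp_neg_inv {P y : ℝ} (hP : 0 < P) (hy : 0 < y) :
    HasStrictDerivAt (fun y => Real.exp (-(P * y)⁻¹)) (costPDF P y) y := by
  have h := ((hasStrictDerivAt_inv (by positivity : P * y ≠ 0)).comp y
    ((hasStrictDerivAt_id y).const_mul P)).neg.exp
  convert! h using 1
  rw [costPDF, if_pos hy]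
  simp
  field_simp

lemma hasStrictDerivAt_costCDF {P y : ℝ} (hP : 0 < P) (hy : 0 < y) :
    HasStrictDerivAt (costCDF P) (costPDF P y) y := by
  refine (hasStrictDerivAt_exp_neg_inv hP hy).congr_of_eventuallyEq ?_
  filter_upwards [lt_mem_nhds hy] with x hx
  simp [costCDF, hx]

lemma costCDF_lt_one {P : ℝ} (hP : 0 < P) (y : ℝ) : costCDF P y < 1 := by
  unfold costCDF
  split_ifs with h
  · rw [Real.exp_lt_one_iff]
    simp; positivity
  · norm_num

lemma tendsto_exp_neg_inv_nhdsGT_zero {P : ℝ} (hP : 0 < P) :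
    Tendsto (fun y => Real.exp (-(P * y)⁻¹)) (𝓝[>] 0) (𝓝 0) := by
  refine Real.tendsto_exp_neg_atTop_nhds_zero.comp ?_
  simp_rw [mul_inv]
  exact tendsto_inv_nhdsGT_zero.const_mul_atTop (inv_pos.2 hP)

lemma continuousOn_costCDF {P : ℝ} (hP : 0 < P) : ContinuousOn (costCDF P) (Set.Ici 0) := by
  intro y hy
  rcases (Set.mem_Ici.1 hy).eq_or_lt with rfl | hy
  · rw [← continuousWithinAt_Ioi_iff_Ici, ContinuousWithinAt]
    have : costCDF P 0 = 0 := if_neg (lt_irrefl _)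
    rw [this]
    refine (tendsto_exp_neg_inv_nhdsGT_zero hP).congr' ?_
    filter_upwards [self_mem_nhdsWithin] with x hx
    exact (if_pos hx).symm
  · exact (hasStrictDerivAt_costCDF hP hy).hasDerivAt.continuousAt.continuousWithinAt

/-- The fundamental theorem of calculus on `[0, y]` needs only continuity at `0`, where
`exp(-1/(Py))` tends to `0`; integrability follows from the nonnegative derivative. -/
lemma setLIntegral_costPDF {P : ℝ} (hP : 0 < P) (y : ℝ) :
    ∫⁻ x in Set.Iic y, ENNReal.ofReal (costPDF P x) = ENNReal.ofReal (costCDF P y) := by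
  have hneg : ∀ z ≤ (0 : ℝ), ∫⁻ x in Set.Iic z, ENNReal.ofReal (costPDF P x) = 0 := by
    intro z hz
    rw [setLIntegral_congr_fun measurableSet_Iic (g := fun _ => 0), lintegral_zero]
    intro x hx
    have : ¬ 0 < x := not_lt.2 ((Set.mem_Iic.1 hx).trans hz)
    simp [costPDF, this]
  rcases le_or_gt y 0 with hy | hy
  · rw [hneg y hy, costCDF, if_neg hy.not_gt, ENNReal.ofReal_zero]
  · have hc : ContinuousOn (costCDF P) (Set.Icc 0 y) :=
      (continuousOn_costCDF hP).mono Set.Icc_subset_Ici_self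
    have hd : ∀ x ∈ Set.Ioo 0 y, HasDerivAt (costCDF P) (costPDF P x) x :=
      fun x hx => (hasStrictDerivAt_costCDF hP hx.1).hasDerivAt
    have hi : IntegrableOn (costPDF P) (Set.Ioc 0 y) :=
      intervalIntegral.integrableOn_deriv_of_nonneg hc hd fun x _ => costPDF_nonneg hP x
    rw [← Set.Iic_union_Ioc_eq_Iic hy.le, lintegral_union measurableSet_Ioc
      (Set.Iic_disjoint_Ioc le_rfl), hneg 0 le_rfl, zero_add,
      ← ofReal_integral_eq_lintegral_ofReal hi (ae_of_all _ fun x => costPDF_nonneg hP x),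
      ← intervalIntegral.integral_of_le hy.le,
      intervalIntegral.integral_eq_sub_of_hasDerivAt_of_le hy.le hc hd
        ((intervalIntegrable_iff_integrableOn_Ioc_of_le hy.le).2 hi)]
    have : costCDF P 0 = 0 := if_neg (lt_irrefl _)
    rw [this, sub_zero]

lemma map_deviceCost_complexGaussianVec {N : ℕ} {P : ℝ} (hP : 0 < P)
    {m : EuclideanSpace ℂ (Fin N)} (hm : ‖m‖ = 1) :
    (complexGaussianVec N).map (deviceCost P m) =
      volume.withDensity (fun y => ENNReal.ofReal (costPDF P y)) := by
  have : IsProbabilityMeasure (complexGaussianVec N) := Measure.isProbabilityMeasure_map (by fun_prop)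
  have : IsProbabilityMeasure ((complexGaussianVec N).map (deviceCost P m)) :=
    Measure.isProbabilityMeasure_map (measurable_deviceCost P m).aemeasurable
  refine Measure.ext_of_Iic _ _ fun y => ?_
  rw [withDensity_apply _ measurableSet_Iic, setLIntegral_costPDF hP,
    Measure.map_apply (measurable_deviceCost P m) measurableSet_Iic, ← measure_deviceCost_le hP hm]
  rfl

lemma hasLaw_deviceCost {N : ℕ} {P : ℝ} (hP : 0 < P) {m : EuclideanSpace ℂ (Fin N)}
    (hm : ‖m‖ = 1) {Ω : Type*} [MeasurableSpace Ω] {μ : Measure Ω}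
    {h : Ω → EuclideanSpace ℂ (Fin N)} (hh : HasLaw h (complexGaussianVec N) μ) :
    HasLaw (fun ω => deviceCost P m (h ω))
      (volume.withDensity (fun y => ENNReal.ofReal (costPDF P y))) μ :=
  HasLaw.fun_comp ⟨(measurable_deviceCost P m).aemeasurable,
    map_deviceCost_complexGaussianVec hP hm⟩ hh

lemma measureReal_deviceCost_le {N : ℕ} {P : ℝ} (hP : 0 < P) {m : EuclideanSpace ℂ (Fin N)}
    (hm : ‖m‖ = 1) {Ω : Type*} [MeasurableSpace Ω] {μ : Measure Ω}
    {h : Ω → EuclideanSpace ℂ (Fin N)} (hh : HasLaw h (complexGaussianVec N) μ) (y : ℝ) :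
    μ.real {ω | deviceCost P m (h ω) ≤ y} = costCDF P y := by
  have := (hasLaw_deviceCost hP hm hh).measureReal_eq (p := fun x => x ≤ y) measurableSet_Iic
  rw [this, measureReal_def]
  change ((volume.withDensity fun y => ENNReal.ofReal (costPDF P y)) (Set.Iic y)).toReal = _
  rw [withDensity_apply _ measurableSet_Iic, setLIntegral_costPDF hP,
    ENNReal.toReal_ofReal (costCDF_nonneg P y)]

/-! ### The quantile function -/

lemma costQuantile_pos {P q : ℝ} (hP : 0 < P) (hq : q ∈ Set.Ioo (0 : ℝ) 1) :
    0 < costQuantile P q :=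
  div_pos_of_neg_of_neg (by norm_num) (mul_neg_of_pos_of_neg hP (Real.log_neg hq.1 hq.2))

lemma costCDF_costQuantile {P q : ℝ} (hP : 0 < P) (hq : q ∈ Set.Ioo (0 : ℝ) 1) :
    costCDF P (costQuantile P q) = q := by
  have := Real.log_neg hq.1 hq.2
  rw [costCDF, if_pos (costQuantile_pos hP hq), costQuantile]
  convert! Real.exp_log hq.1 using 2
  field_simp

lemma costQuantile_costCDF {P y : ℝ} (hP : 0 < P) (hy : 0 < y) :
    costQuantile P (costCDF P y) = y := by
  rw [costCDF, if_pos hy, costQuantile, Real.log_exp]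
  field_simp

lemma costCDF_mem_Ioo {P y : ℝ} (hP : 0 < P) (hy : 0 < y) : costCDF P y ∈ Set.Ioo (0 : ℝ) 1 :=
  ⟨by rw [costCDF, if_pos hy]; positivity, costCDF_lt_one hP y⟩

lemma invOn_costQuantile {P : ℝ} (hP : 0 < P) :
    Set.InvOn (costQuantile P) (costCDF P) (Set.Ioi 0) (Set.Ioo 0 1) :=
  ⟨fun _ hy => costQuantile_costCDF hP hy, fun _ hq => costCDF_costQuantile hP hq⟩

lemma bijOn_costCDF {P : ℝ} (hP : 0 < P) :
    Set.BijOn (costCDF P) (Set.Ioi 0) (Set.Ioo 0 1) :=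
  (invOn_costQuantile hP).bijOn (fun _ hy => costCDF_mem_Ioo hP hy)
    (fun _ hq => costQuantile_pos hP hq)

/-! ### Central limit theorem for binomial counts -/

/-- If `k n * g n → L` with `k n → ∞` then `(1 + g n) ^ k n → exp L`. -/
lemma tendsto_one_add_pow_exp_comp {k : ℕ → ℕ} (hk : Tendsto k atTop atTop) {g : ℕ → ℂ} {L : ℂ}
    (hg : Tendsto (fun n => (k n : ℂ) * g n) atTop (𝓝 L)) :
    Tendsto (fun n => (1 + g n) ^ k n) atTop (𝓝 (Complex.exp L)) := by
  have hkinv : Tendsto (fun n => ((k n : ℂ))⁻¹) atTop (𝓝 0) :=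
    (tendsto_inv_atTop_nhds_zero_nat (𝕜 := ℂ)).comp hk
  have hk0 : ∀ᶠ n in atTop, (k n : ℂ) ≠ 0 := by
    filter_upwards [hk.eventually_gt_atTop 0] with n hn
    exact_mod_cast hn.ne'
  have hg0 : Tendsto g atTop (𝓝 0) := by
    have := hkinv.mul hg
    rw [zero_mul] at this
    refine this.congr' ?_
    filter_upwards [hk0] with n hn
    field_simp
  have hg1 : Tendsto (fun n => 1 + g n) atTop (𝓝 1) := by simpa using hg0.const_add 1
  -- `dslope` writes `log (1 + g)` as `g` times a factor tending to `1`, even where `g` vanishes.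
  have hd : Tendsto (fun n => dslope Complex.log 1 (1 + g n)) atTop (𝓝 1) := by
    have hlog : HasDerivAt Complex.log 1 1 := by
      simpa using Complex.hasDerivAt_log Complex.one_mem_slitPlane
    have hc : ContinuousAt (dslope Complex.log 1) 1 :=
      continuousAt_dslope_same.2 hlog.differentiableAt
    have := hc.tendsto.comp hg1
    rwa [dslope_same, hlog.deriv] at this
  have hmul := (hg.mul hd).cexp
  rw [mul_one] at hmul
  refine hmul.congr' ?_
  filter_upwards [hg1.eventually_ne (one_ne_zero)] with n hn
  have h1 := sub_smul_dslope Complex.log 1 (1 + g n)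
  simp only [add_sub_cancel_left, smul_eq_mul, Complex.log_one, sub_zero] at h1
  rw [mul_assoc, h1, Complex.exp_nat_mul, Complex.exp_log hn]

/-- Second order remainder of the exponential function. -/
noncomputable def expRemainder (z : ℂ) : ℂ := dslope (dslope Complex.exp 0) 0 z

lemma exp_eq_add_expRemainder (z : ℂ) :
    Complex.exp z = 1 + z + z ^ 2 * expRemainder z := by
  have h1 := sub_smul_dslope Complex.exp 0 z
  have h2 := sub_smul_dslope (dslope Complex.exp 0) 0 z
  simp only [sub_zero, smul_eq_mul, dslope_same, Complex.deriv_exp, Complex.exp_zero] at h1 h2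
  rw [expRemainder]
  linear_combination (-1 : ℂ) * h1 - z * h2

/-- Away from `0` the cubic Taylor bound gives the limit; holomorphy makes the function continuous
at `0`, so its value there is the same limit. -/
lemma tendsto_expRemainder : Tendsto expRemainder (𝓝 0) (𝓝 (1 / 2)) := by
  have hlim : Tendsto expRemainder (𝓝[≠] 0) (𝓝 (1 / 2)) := by
    rw [tendsto_iff_norm_sub_tendsto_zero]
    have hb : Tendsto (fun z : ℂ => ‖z‖ * Real.exp ‖z‖) (𝓝[≠] 0) (𝓝 0) := by
      have : Tendsto (fun z : ℂ => ‖z‖ * Real.exp ‖z‖) (𝓝 0) (𝓝 (‖(0 : ℂ)‖ * Real.exp ‖(0 : ℂ)‖)) :=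
        Continuous.tendsto (by fun_prop) _
      rw [norm_zero, zero_mul] at this
      exact this.mono_left nhdsWithin_le_nhds
    refine squeeze_zero' (Eventually.of_forall fun _ => norm_nonneg _) ?_ hb
    filter_upwards [self_mem_nhdsWithin] with z hz
    have hz : z ≠ 0 := hz
    have h := Complex.norm_exp_sub_sum_le_norm_mul_exp z 3
    have he : Complex.exp z - ∑ m ∈ Finset.range 3, z ^ m / (m.factorial : ℂ) =
        z ^ 2 * (expRemainder z - 1 / 2) := by
      rw [exp_eq_add_expRemainder z]
      simp [Finset.sum_range_succ]
      ring
    rw [he, norm_mul, norm_pow] at h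
    have hp : 0 < ‖z‖ ^ 2 := by have := norm_pos_iff.2 hz; positivity
    refine le_of_mul_le_mul_left (h.trans_eq ?_) hp
    ring
  have hc : ContinuousAt expRemainder 0 := by
    refine continuousAt_dslope_same.2 ?_
    have : DifferentiableOn ℂ (dslope Complex.exp 0) Set.univ :=
      (Complex.differentiableOn_dslope univ_mem).2 Complex.differentiable_exp.differentiableOn
    exact (differentiableOn_univ.1 this) 0
  have := tendsto_nhds_unique (hc.tendsto.mono_left nhdsWithin_le_nhds) hlim
  rw [← this]
  exact hc.tendsto

/-- The characteristic functions of normalized centred binomial variables converge. -/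
lemma tendsto_charFun_bernoulli_pow {k : ℕ → ℕ} (hk : Tendsto k atTop atTop) {a : ℕ → ℝ} {p : ℝ}
    (ha : Tendsto a atTop (𝓝 p)) (t : ℝ) :
    Tendsto (fun n => ((a n : ℂ) * Complex.exp (((t / √(k n) * (1 - a n) : ℝ) : ℂ) * Complex.I) +
      (1 - a n) * Complex.exp (((t / √(k n) * (0 - a n) : ℝ) : ℂ) * Complex.I)) ^ k n) atTop
      (𝓝 (Complex.exp (-((p * (1 - p) * t ^ 2 / 2 : ℝ) : ℂ)))) := by
  have hθ : Tendsto (fun n => t / √(k n)) atTop (𝓝 0) :=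
    tendsto_const_nhds.div_atTop (Real.tendsto_sqrt_atTop.comp (tendsto_natCast_atTop_atTop.comp hk))
  set u : ℕ → ℂ := fun n => ((t / √(k n) * (1 - a n) : ℝ) : ℂ) * Complex.I
  set v : ℕ → ℂ := fun n => ((t / √(k n) * (0 - a n) : ℝ) : ℂ) * Complex.I
  have hu : Tendsto u atTop (𝓝 0) := by
    have := ((Complex.continuous_ofReal.tendsto _).comp (hθ.mul (ha.const_sub 1))).mul_const Complex.I
    rwa [zero_mul, Complex.ofReal_zero, zero_mul] at this
  have hv : Tendsto v atTop (𝓝 0) := by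
    have := ((Complex.continuous_ofReal.tendsto _).comp (hθ.mul (ha.const_sub 0))).mul_const Complex.I
    rwa [zero_mul, Complex.ofReal_zero, zero_mul] at this
  have haC : Tendsto (fun n => (a n : ℂ)) atTop (𝓝 p) := (Complex.continuous_ofReal.tendsto _).comp ha
  -- The linear terms of the two exponentials cancel because the indicator is centred; this is `k n`
  -- times what remains.
  have hg : Tendsto (fun n => -(t : ℂ) ^ 2 * ((a n : ℂ) * (1 - a n) ^ 2 * expRemainder (u n) +
      (1 - a n) * (a n) ^ 2 * expRemainder (v n))) atTop
      (𝓝 (-((p * (1 - p) * t ^ 2 / 2 : ℝ) : ℂ))) := by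
    have h1 := (((haC.mul ((haC.const_sub 1).pow 2)).mul (tendsto_expRemainder.comp hu)).add
      (((haC.const_sub 1).mul (haC.pow 2)).mul (tendsto_expRemainder.comp hv))).const_mul
        (-(t : ℂ) ^ 2)
    convert! h1 using 2
    push_cast
    ring
  have key : Tendsto (fun n => (k n : ℂ) * ((a n : ℂ) * Complex.exp (u n) +
      (1 - a n) * Complex.exp (v n) - 1)) atTop (𝓝 (-((p * (1 - p) * t ^ 2 / 2 : ℝ) : ℂ))) := by
    refine hg.congr' ?_
    filter_upwards [hk.eventually_gt_atTop 0] with n hn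
    have hs : ((√(k n) : ℝ) : ℂ) ^ 2 = (k n : ℂ) := by
      rw [← Complex.ofReal_pow, Real.sq_sqrt (Nat.cast_nonneg _)]
      simp
    have hs0 : ((√(k n) : ℝ) : ℂ) ≠ 0 := by
      have : 0 < √(k n : ℝ) := Real.sqrt_pos.2 (by exact_mod_cast hn)
      exact_mod_cast this.ne'
    rw [exp_eq_add_expRemainder (u n), exp_eq_add_expRemainder (v n), ← hs]
    generalize expRemainder (u n) = r1
    generalize expRemainder (v n) = r2
    simp only [u, v]
    push_cast
    field_simp
    ring_nf
    simp only [Complex.I_sq]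
    ring
  refine (tendsto_one_add_pow_exp_comp hk key).congr fun n => ?_
  rw [add_sub_cancel]

/-- The characteristic function of a normalized sum of i.i.d. centred indicators. -/
lemma charFun_map_sum_indicator {Ω : Type*} [MeasurableSpace Ω] {μ : Measure Ω}
    [IsProbabilityMeasure μ] {k : ℕ} {Y : Fin k → Ω → ℝ} (hY : ∀ i, AEMeasurable (Y i) μ)
    (hind : iIndepFun Y μ) {x a : ℝ} (ha : ∀ i, μ.real {ω | Y i ω ≤ x} = a) (b s t : ℝ) :
    charFun (μ.map (fun ω => (∑ i, ((Set.Iic x).indicator 1 (Y i ω) - a)) / s + b)) t =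
      ((a : ℂ) * Complex.exp (((t / s * (1 - a) : ℝ) : ℂ) * Complex.I) +
        (1 - a) * Complex.exp (((t / s * (0 - a) : ℝ) : ℂ) * Complex.I)) ^ k *
        Complex.exp (((t * b : ℝ) : ℂ) * Complex.I) := by
  have hφ : Measurable (fun y : ℝ => (Set.Iic x).indicator (1 : ℝ → ℝ) y - a) :=
    (measurable_one.indicator measurableSet_Iic).sub_const a
  have hX : ∀ i, AEMeasurable (fun ω => (Set.Iic x).indicator (1 : ℝ → ℝ) (Y i ω) - a) μ :=
    fun i => hφ.comp_aemeasurable (hY i)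
  have hind' : iIndepFun (fun i ω => (Set.Iic x).indicator (1 : ℝ → ℝ) (Y i ω) - a) μ :=
    hind.comp (fun _ y => (Set.Iic x).indicator (1 : ℝ → ℝ) y - a) (fun _ => hφ)
  have hsum : AEMeasurable (fun ω => ∑ i, ((Set.Iic x).indicator (1 : ℝ → ℝ) (Y i ω) - a)) μ :=
    Finset.aemeasurable_fun_sum _ fun i _ => hX i
  have hmap : μ.map (fun ω => (∑ i, ((Set.Iic x).indicator (1 : ℝ → ℝ) (Y i ω) - a)) / s + b) =
      (μ.map (fun ω => s⁻¹ * ∑ i, ((Set.Iic x).indicator (1 : ℝ → ℝ) (Y i ω) - a))).map (· + b) := by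
    rw [AEMeasurable.map_map_of_aemeasurable (by fun_prop) (hsum.const_mul _)]
    congr 1
    ext ω
    simp [div_eq_inv_mul]
  rw [hmap, charFun_map_add_const, charFun_map_mul_comp hsum,
    hind'.charFun_map_fun_sum_eq_prod hX, Finset.prod_apply]
  congr 1
  refine (Finset.prod_congr rfl fun i _ => ?_).trans (by rw [Finset.prod_const, Finset.card_fin])
  -- A measurable version makes the event `Z ≤ x` measurable, so the integral splits over it and its
  -- complement.
  obtain ⟨Z, hZm, hZ⟩ := hY i
  have hZa : μ.real {ω | Z ω ≤ x} = a := by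
    rw [← ha i]
    refine measureReal_congr ?_
    filter_upwards [hZ] with ω hω
    change (Z ω ≤ x) = (Y i ω ≤ x)
    rw [hω]
  have hAm : MeasurableSet {ω | Z ω ≤ x} := measurableSet_le hZm measurable_const
  rw [charFun_apply_real, integral_map (hX i) (by fun_prop)]
  have : (fun ω => Complex.exp (((s⁻¹ * t : ℝ) : ℂ) *
      (((Set.Iic x).indicator (1 : ℝ → ℝ) (Y i ω) - a : ℝ) : ℂ) * Complex.I)) =ᵐ[μ]
      fun ω => {ω | Z ω ≤ x}.indicator
        (fun _ => Complex.exp (((t / s * (1 - a) : ℝ) : ℂ) * Complex.I)) ω +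
      {ω | Z ω ≤ x}ᶜ.indicator
        (fun _ => Complex.exp (((t / s * (0 - a) : ℝ) : ℂ) * Complex.I)) ω := by
    filter_upwards [hZ] with ω hω
    rw [hω, ← Complex.ofReal_mul, inv_mul_eq_div]
    by_cases hc : Z ω ≤ x
    · rw [Set.indicator_of_mem (by exact hc), Set.indicator_of_mem (by exact hc),
        Set.indicator_of_notMem (by simpa using hc)]
      simp
    · rw [Set.indicator_of_notMem (by exact hc), Set.indicator_of_notMem (by exact hc),
        Set.indicator_of_mem (by exact hc)]
      simp
  rw [integral_congr_ae this, integral_add ((integrable_const _).indicator hAm)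
    ((integrable_const _).indicator hAm.compl), integral_indicator_const _ hAm,
    integral_indicator_const _ hAm.compl, probReal_compl_eq_one_sub hAm, hZa]
  simp

/-- A central limit theorem for binomial counts with converging success probabilities, in the form
of the convergence of the probabilities of upper tails. -/
lemma tendsto_measure_le_card {Ω : ℕ → Type*} [∀ n, MeasurableSpace (Ω n)]
    {μ : (n : ℕ) → Measure (Ω n)} [∀ n, IsProbabilityMeasure (μ n)] {k : ℕ → ℕ}
    (hk : Tendsto k atTop atTop) {Y : (n : ℕ) → Fin (k n) → Ω n → ℝ}
    (hY : ∀ n i, AEMeasurable (Y n i) (μ n)) (hind : ∀ n, iIndepFun (Y n) (μ n))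
    {x a b : ℕ → ℝ} (hxa : ∀ n i, (μ n).real {ω | Y n i ω ≤ x n} = a n)
    {p c : ℝ} (ha : Tendsto a atTop (𝓝 p)) (hp : p ∈ Set.Ioo (0 : ℝ) 1)
    (hb : Tendsto b atTop (𝓝 c)) :
    Tendsto (fun n => μ n
      {ω | 0 ≤ (∑ i, ((Set.Iic (x n)).indicator 1 (Y n i ω) - a n)) / √(k n) + b n}) atTop
      (𝓝 (gaussianReal c (p * (1 - p)).toNNReal (Set.Ici 0))) := by
  set W : (n : ℕ) → Ω n → ℝ :=
    fun n ω => (∑ i, ((Set.Iic (x n)).indicator 1 (Y n i ω) - a n)) / √(k n) + b n with hW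
  have hWm : ∀ n, AEMeasurable (W n) (μ n) := fun n =>
    ((Finset.aemeasurable_fun_sum _ fun i _ => ((measurable_one.indicator
      measurableSet_Iic).comp_aemeasurable (hY n i)).sub_const _).div_const _).add_const _
  have hpp : 0 < p * (1 - p) := mul_pos hp.1 (sub_pos.2 hp.2)
  let ν : ℕ → ProbabilityMeasure ℝ :=
    fun n => ⟨(μ n).map (W n), Measure.isProbabilityMeasure_map (hWm n)⟩
  let ν₀ : ProbabilityMeasure ℝ := ⟨gaussianReal c (p * (1 - p)).toNNReal, inferInstance⟩
  have hν : Tendsto ν atTop (𝓝 ν₀) := by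
    refine ProbabilityMeasure.tendsto_of_tendsto_charFun fun t => ?_
    have h1 := (tendsto_charFun_bernoulli_pow hk ha t).mul
      (((Complex.continuous_ofReal.tendsto _).comp (hb.const_mul t)).mul_const Complex.I).cexp
    have h2 : charFun (ν₀ : Measure ℝ) t = Complex.exp (-((p * (1 - p) * t ^ 2 / 2 : ℝ) : ℂ)) *
        Complex.exp (((t * c : ℝ) : ℂ) * Complex.I) := by
      change charFun (gaussianReal c _) t = _
      rw [charFun_gaussianReal, Real.coe_toNNReal _ hpp.le, ← Complex.exp_add]
      congr 1
      push_cast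
      ring
    rw [h2]
    refine h1.congr fun n => ?_
    exact (charFun_map_sum_indicator (hY n) (hind n) (hxa n) (b n) √(k n) t).symm
  -- A nondegenerate limit has no atom at `0`, so the half-line is a continuity set.
  have : NullSingletonClass (ν₀ : Measure ℝ) :=
    nullSingletonClass_gaussianReal (by simpa using hpp)
  have hlim := ProbabilityMeasure.tendsto_measure_of_null_frontier_of_tendsto' hν
    (E := Set.Ici 0) (by rw [frontier_Ici]; exact measure_singleton _)
  refine hlim.congr fun n => ?_
  exact Measure.map_apply_of_aemeasurable (hWm n) measurableSet_Ici

/-! ### Order statistics, weak convergence and the Gaussian tail -/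

/-- An optimal set has all its values `≤ x` exactly when enough such indices exist to choose `S` of
them. -/
lemma minMaxCost_le_iff {K S : ℕ} (hS : 0 < S) (hSK : S ≤ K) (y : Fin K → ℝ) (x : ℝ) :
    minMaxCost S y ≤ x ↔ S ≤ (Finset.univ.filter (fun k => y k ≤ x)).card := by
  unfold minMaxCost
  have hne : Nonempty {A : Finset (Fin K) // A.card = S} := by
    obtain ⟨A, -, hA⟩ := Finset.exists_subset_card_eq (s := (Finset.univ : Finset (Fin K))) (n := S)
      (by simpa using hSK)
    exact ⟨⟨A, hA⟩⟩
  constructor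
  · intro h
    obtain ⟨A, hA⟩ := exists_eq_ciInf_of_finite
      (f := fun A : {A : Finset (Fin K) // A.card = S} => ⨆ k : {k : Fin K // k ∈ A.1}, y k.1)
    rw [← hA] at h
    rw [← A.2]
    refine Finset.card_le_card fun k hk => ?_
    simp only [Finset.mem_filter, Finset.mem_univ, true_and]
    exact (le_ciSup (f := fun k : {k : Fin K // k ∈ A.1} => y k.1)
      (Set.finite_range _).bddAbove ⟨k, hk⟩).trans h
  · intro h
    obtain ⟨A, hAs, hA⟩ := Finset.exists_subset_card_eq h
    refine (ciInf_le (Set.finite_range _).bddBelow ⟨A, hA⟩).trans ?_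
    -- Nonemptiness is needed: a real supremum over the empty type has the default value `0`.
    obtain ⟨k, hk⟩ := Finset.card_pos.1 (hA ▸ hS)
    have : Nonempty {k : Fin K // k ∈ A} := ⟨⟨k, hk⟩⟩
    exact ciSup_le fun k => (Finset.mem_filter.1 (hAs k.2)).2

lemma measurable_minMaxCost {K : ℕ} (S : ℕ) :
    Measurable (minMaxCost S : (Fin K → ℝ) → ℝ) := by
  unfold minMaxCost
  exact Measurable.iInf fun A => Measurable.iSup fun k => measurable_pi_apply _

/-- Convergence of distribution functions at every point implies weak convergence. -/
lemma tendsto_probabilityMeasure_of_tendsto_Iic {ι : Type*} {l : Filter ι}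
    [l.IsCountablyGenerated] {ν : ι → ProbabilityMeasure ℝ} {ν₀ : ProbabilityMeasure ℝ}
    (h : ∀ t, Tendsto (fun i => (ν i : Measure ℝ) (Set.Iic t)) l
      (𝓝 ((ν₀ : Measure ℝ) (Set.Iic t)))) :
    Tendsto ν l (𝓝 ν₀) := by
  -- Half-open intervals form a π-system containing small neighbourhoods of every point, and their
  -- measures are differences of distribution functions.
  refine (isPiSystem_Ioc (id : ℝ → ℝ) id).tendsto_probabilityMeasure_of_tendsto_of_mem ?_ ?_ ?_
  · rintro _ ⟨a, b, -, rfl⟩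
    exact measurableSet_Ioc
  · intro u hu x hx
    obtain ⟨a, b, hab, hsub⟩ := mem_nhds_iff_exists_Ioo_subset.1 (hu.mem_nhds hx)
    obtain ⟨c, hxc, hcb⟩ := exists_between hab.2
    refine ⟨Set.Ioc a c, ⟨a, c, hab.1.trans hxc, rfl⟩, Ioc_mem_nhds hab.1 hxc, ?_⟩
    exact (Set.Ioc_subset_Ioo_right hcb).trans hsub
  · rintro _ ⟨a, b, hab, rfl⟩
    simp only [id] at hab
    have hreal : ∀ μ : ProbabilityMeasure ℝ, ((μ : Measure ℝ) (Set.Ioc a b)) =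
        (μ : Measure ℝ) (Set.Iic b) - (μ : Measure ℝ) (Set.Iic a) := fun μ => by
      rw [← Set.Iic_sdiff_Iic, measure_sdiff (Set.Iic_subset_Iic.2 hab.le)
        measurableSet_Iic.nullMeasurableSet (measure_ne_top _ _)]
    have hlim : Tendsto (fun i => (ν i : Measure ℝ) (Set.Ioc a b)) l
        (𝓝 ((ν₀ : Measure ℝ) (Set.Ioc a b))) := by
      simp_rw [hreal]
      exact ENNReal.Tendsto.sub (h b) (h a) (Or.inl (measure_ne_top _ _))
    exact (ENNReal.tendsto_toNNReal (measure_ne_top _ _)).comp hlim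

/-- For `Z` standard normal, `-√v Z + t√v` has the law on the left and is nonnegative exactly when
`Z ≤ t`. -/
lemma gaussianReal_Ici_zero {v : ℝ} (hv : 0 < v) (t : ℝ) :
    gaussianReal (t * √v) v.toNNReal (Set.Ici 0) = gaussianReal 0 1 (Set.Iic t) := by
  have h : ((gaussianReal 0 1).map (-√v * ·)).map (· + t * √v) =
      gaussianReal (t * √v) v.toNNReal := by
    rw [gaussianReal_map_const_mul, gaussianReal_map_add_const]
    congr 1
    · simp
    · ext
      simp [Real.sq_sqrt hv.le, hv.le]
  rw [← h, Measure.map_map (by fun_prop) (by fun_prop),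
    Measure.map_apply (by fun_prop) measurableSet_Ici]
  congr 1
  ext z
  have := Real.sqrt_pos.2 hv
  simp only [Set.mem_preimage, Function.comp_apply, Set.mem_Ici, Set.mem_Iic]
  constructor
  · intro h1
    refine le_of_mul_le_mul_right (a := √v) ?_ this
    linarith
  · intro h1
    nlinarith

/-! ### Asymptotics of the threshold -/

lemma continuousAt_costQuantile {P q : ℝ} (hP : 0 < P) (hq : q ∈ Set.Ioo (0 : ℝ) 1) :
    ContinuousAt (costQuantile P) q := by
  unfold costQuantile
  have := Real.log_neg hq.1 hq.2
  exact continuousAt_const.div (continuousAt_const.mul (Real.continuousAt_log hq.1.ne'))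
    (mul_neg_of_pos_of_neg hP this).ne

lemma costPDF_pos {P y : ℝ} (hP : 0 < P) (hy : 0 < y) : 0 < costPDF P y := by
  rw [costPDF, if_pos hy]; positivity

lemma continuousAt_costPDF {P y : ℝ} (hP : 0 < P) (hy : 0 < y) : ContinuousAt (costPDF P) y := by
  have : ContinuousAt (fun y => (P * y ^ 2)⁻¹ * Real.exp (-(P * y)⁻¹)) y := by
    have h1 : P * y ^ 2 ≠ 0 := by positivity
    have h2 : P * y ≠ 0 := by positivity
    fun_prop (disch := assumption)
  refine this.congr ?_
  filter_upwards [lt_mem_nhds hy] with x hx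
  simp [costPDF, hx]

/-- The threshold corresponding to the value `t` of the normalized order statistic. -/
noncomputable def costThreshold (P q k t : ℝ) : ℝ :=
  costQuantile P q + t * √(q * (1 - q)) / (√k * costPDF P (costQuantile P q))

lemma tendsto_costThreshold {P p : ℝ} (hP : 0 < P) (hp : p ∈ Set.Ioo (0 : ℝ) 1) {q k : ℕ → ℝ}
    (hq : Tendsto q atTop (𝓝 p)) (hk : Tendsto k atTop atTop) (hqm : ∀ n, q n ∈ Set.Ioo (0 : ℝ) 1)
    (t : ℝ) :
    Tendsto (fun n => √(k n) * (costCDF P (costThreshold P (q n) (k n) t) - q n)) atTop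
      (𝓝 (t * √(p * (1 - p)))) ∧
    Tendsto (fun n => costCDF P (costThreshold P (q n) (k n) t)) atTop (𝓝 p) := by
  have hQp := costQuantile_pos hP hp
  have hf0 := costPDF_pos hP hQp
  have hQ : Tendsto (fun n => costQuantile P (q n)) atTop (𝓝 (costQuantile P p)) :=
    (continuousAt_costQuantile hP hp).tendsto.comp hq
  have hf : Tendsto (fun n => costPDF P (costQuantile P (q n))) atTop
      (𝓝 (costPDF P (costQuantile P p))) := (continuousAt_costPDF hP hQp).tendsto.comp hQ
  have hσ : Tendsto (fun n => √(q n * (1 - q n))) atTop (𝓝 √(p * (1 - p))) :=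
    (hq.mul (hq.const_sub 1)).sqrt
  have hsk : Tendsto (fun n => √(k n)) atTop atTop := Real.tendsto_sqrt_atTop.comp hk
  have hd : Tendsto (fun n => √(k n) * (costThreshold P (q n) (k n) t - costQuantile P (q n))) atTop
      (𝓝 (t * √(p * (1 - p)) / costPDF P (costQuantile P p))) := by
    refine ((hσ.const_mul t).div hf hf0.ne').congr' ?_
    filter_upwards [hsk.eventually_gt_atTop 0] with n hn
    simp only [Pi.div_apply, costThreshold, add_sub_cancel_left]
    have := costPDF_pos hP (costQuantile_pos hP (hqm n))
    field_simp
  have hx : Tendsto (fun n => costThreshold P (q n) (k n) t) atTop (𝓝 (costQuantile P p)) := by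
    have h1 := (hsk.inv_tendsto_atTop.mul hd).add hQ
    rw [zero_mul, zero_add] at h1
    refine h1.congr' ?_
    filter_upwards [hsk.eventually_gt_atTop 0] with n hn
    simp only [Pi.inv_apply]
    field_simp
    ring
  -- Strict differentiability is essential: the threshold and `F⁻¹(q n)` both move towards `F⁻¹(p)`,
  -- and no rate for `q n → p` is assumed.
  have hD := hasStrictDerivAt_costCDF hP hQp
  refine ⟨?_, ?_⟩
  · have ho := hD.isLittleO.comp_tendsto (hx.prodMk_nhds hQ)
    have ho2 : Tendsto (fun n => √(k n) *
        (costCDF P (costThreshold P (q n) (k n) t) - costCDF P (costQuantile P (q n)) -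
          (costThreshold P (q n) (k n) t - costQuantile P (q n)) * costPDF P (costQuantile P p)))
        atTop (𝓝 0) := by
      have h1 := (Asymptotics.isBigO_refl (fun n => √(k n)) atTop).mul_isLittleO ho
      refine ((Asymptotics.isLittleO_one_iff ℝ).1
        (h1.trans_isBigO (hd.isBigO_one ℝ))).congr fun n => ?_
      simp
    have := ho2.add (hd.mul_const (costPDF P (costQuantile P p)))
    rw [zero_add, div_mul_cancel₀ _ hf0.ne'] at this
    refine this.congr fun n => ?_
    rw [costCDF_costQuantile hP (hqm n)]
    ring
  · have := hD.hasDerivAt.continuousAt.tendsto.comp hx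
    rwa [costCDF_costQuantile hP hp] at this

/-! ### Asymptotic normality -/

lemma sum_indicator_sub {K : ℕ} (y : Fin K → ℝ) (x a : ℝ) :
    ∑ i, ((Set.Iic x).indicator (1 : ℝ → ℝ) (y i) - a) =
      ((Finset.univ.filter (fun k => y k ≤ x)).card : ℝ) - K * a := by
  rw [Finset.sum_sub_distrib, Finset.card_filter]
  simp [Set.indicator_apply]

theorem lemma2
    (N : ℕ) (P : ℝ) (hP : 0 < P)
    -- the numbers of devices and of selected devices, in the central regime
    (K S : ℕ → ℕ) (hS : ∀ n, 0 < S n) (hSK : ∀ n, S n < K n)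
    (hK : Tendsto K atTop atTop)
    (p : ℝ) (hp : p ∈ Set.Ioo (0 : ℝ) 1)
    (hq : Tendsto (fun n => (S n : ℝ) / (K n : ℝ)) atTop (𝓝 p))
    -- for each `n`, a unit vector and `K n` i.i.d. channels of law `CN(0, I)`
    {Ω : ℕ → Type*} [∀ n, MeasurableSpace (Ω n)]
    (μ : (n : ℕ) → Measure (Ω n)) [∀ n, IsProbabilityMeasure (μ n)]
    (m : ℕ → EuclideanSpace ℂ (Fin N)) (hm : ∀ n, ‖m n‖ = 1)
    (h : (n : ℕ) → Fin (K n) → Ω n → EuclideanSpace ℂ (Fin N))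
    (hlaw : ∀ n k, HasLaw (h n k) (complexGaussianVec N) (μ n))
    (hindep : ∀ n, iIndepFun (h n) (μ n)) :
    -- `F` is the distribution function of every `Y_k`
    (∀ n k y, (μ n).real {ω | deviceCost P (m n) (h n k ω) ≤ y} = costCDF P y) ∧
    -- `f` is the density of every `Y_k`
    (∀ n k, HasLaw (fun ω => deviceCost P (m n) (h n k ω))
      (volume.withDensity (fun y => ENNReal.ofReal (costPDF P y))) (μ n)) ∧
    -- `F` is a bijection from `(0, ∞)` to `(0, 1)` with inverse `F⁻¹`
    (Set.BijOn (costCDF P) (Set.Ioi 0) (Set.Ioo 0 1) ∧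
      Set.InvOn (costQuantile P) (costCDF P) (Set.Ioi 0) (Set.Ioo 0 1)) ∧
    -- asymptotic normality of `X`, with `q = S / K`
    TendstoInDistribution
      (fun n ω =>
        √(K n : ℝ) * costPDF P (costQuantile P ((S n : ℝ) / (K n : ℝ))) *
          (minMaxCost (S n) (fun k => deviceCost P (m n) (h n k ω)) -
            costQuantile P ((S n : ℝ) / (K n : ℝ))) /
          √((S n : ℝ) / (K n : ℝ) * (1 - (S n : ℝ) / (K n : ℝ))))
      atTop (id : ℝ → ℝ) μ (gaussianReal 0 1) := by
  have hY : ∀ n k, HasLaw (fun ω => deviceCost P (m n) (h n k ω))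
      (volume.withDensity (fun y => ENNReal.ofReal (costPDF P y))) (μ n) :=
    fun n k => hasLaw_deviceCost hP (hm n) (hlaw n k)
  have hcdf : ∀ n k y, (μ n).real {ω | deviceCost P (m n) (h n k ω) ≤ y} = costCDF P y :=
    fun n k y => measureReal_deviceCost_le hP (hm n) (hlaw n k) y
  refine ⟨hcdf, hY, ⟨bijOn_costCDF hP, invOn_costQuantile hP⟩, ?_⟩
  have hYind : ∀ n, iIndepFun (fun k ω => deviceCost P (m n) (h n k ω)) (μ n) := fun n =>
    (hindep n).comp (fun _ => deviceCost P (m n)) fun _ => measurable_deviceCost P (m n)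
  have hKpos : ∀ n, (0 : ℝ) < K n := fun n => by exact_mod_cast (hS n).trans (hSK n)
  have hqm : ∀ n, (S n : ℝ) / K n ∈ Set.Ioo (0 : ℝ) 1 := fun n =>
    ⟨div_pos (by exact_mod_cast hS n) (hKpos n),
      (div_lt_one (hKpos n)).2 (by exact_mod_cast hSK n)⟩
  have hX : ∀ n, AEMeasurable (fun ω => minMaxCost (S n) (fun k => deviceCost P (m n) (h n k ω)))
      (μ n) := fun n =>
    (measurable_minMaxCost (S n)).comp_aemeasurable
      (aemeasurable_pi_lambda _ fun k => (hY n k).aemeasurable)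
  have hZ := fun n => (((hX n).sub_const (costQuantile P ((S n : ℝ) / (K n : ℝ)))).const_mul
    (√(K n : ℝ) * costPDF P (costQuantile P ((S n : ℝ) / (K n : ℝ))))).div_const
      √((S n : ℝ) / (K n : ℝ) * (1 - (S n : ℝ) / (K n : ℝ)))
  refine ⟨hZ, aemeasurable_id, tendsto_probabilityMeasure_of_tendsto_Iic fun t => ?_⟩
  obtain ⟨hb, ha⟩ := tendsto_costThreshold hP hp hq (tendsto_natCast_atTop_atTop.comp hK) hqm t
  have hlim := tendsto_measure_le_card hK (fun n k => (hY n k).aemeasurable) hYind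
    (x := fun n => costThreshold P ((S n : ℝ) / K n) (K n) t) (fun n k => hcdf n k _) ha hp hb
  rw [gaussianReal_Ici_zero (mul_pos hp.1 (sub_pos.2 hp.2))] at hlim
  simp only [ProbabilityMeasure.coe_mk, Measure.map_id]
  refine hlim.congr fun n => ?_
  rw [Measure.map_apply_of_aemeasurable (hZ n) measurableSet_Iic]
  congr 1
  ext ω
  have hs : 0 < √(K n : ℝ) := Real.sqrt_pos.2 (hKpos n)
  have hσ : 0 < √((S n : ℝ) / (K n : ℝ) * (1 - (S n : ℝ) / (K n : ℝ))) :=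
    Real.sqrt_pos.2 (mul_pos (hqm n).1 (sub_pos.2 (hqm n).2))
  have hf : 0 < costPDF P (costQuantile P ((S n : ℝ) / (K n : ℝ))) :=
    costPDF_pos hP (costQuantile_pos hP (hqm n))
  have hthr : minMaxCost (S n) (fun k => deviceCost P (m n) (h n k ω)) ≤
      costThreshold P ((S n : ℝ) / K n) (K n) t ↔
      √(K n : ℝ) * costPDF P (costQuantile P ((S n : ℝ) / (K n : ℝ))) *
          (minMaxCost (S n) (fun k => deviceCost P (m n) (h n k ω)) -
            costQuantile P ((S n : ℝ) / (K n : ℝ))) /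
          √((S n : ℝ) / (K n : ℝ) * (1 - (S n : ℝ) / (K n : ℝ))) ≤ t := by
    rw [costThreshold, ← sub_le_iff_le_add', le_div_iff₀ (mul_pos hs hf), div_le_iff₀ hσ, mul_comm]
  simp only [Set.mem_ofPred_eq, Set.mem_preimage, Set.mem_Iic]
  rw [← hthr, minMaxCost_le_iff (hS n) (hSK n).le, sum_indicator_sub]
  simp only [Function.comp_apply]
  generalize costCDF P (costThreshold P ((S n : ℝ) / K n) (K n) t) = a
  have hsq : √(K n : ℝ) * √(K n : ℝ) = K n := Real.mul_self_sqrt (hKpos n).le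
  -- The terms `K a` of fluctuation and drift cancel, leaving the comparison of the count with `S
  -- n`.
  have hsum : ((Finset.univ.filter (fun k => deviceCost P (m n) (h n k ω) ≤
        costThreshold P ((S n : ℝ) / K n) (K n) t)).card - K n * a) / √(K n : ℝ) +
      √(K n : ℝ) * (a - (S n : ℝ) / K n) =
      (((Finset.univ.filter (fun k => deviceCost P (m n) (h n k ω) ≤
        costThreshold P ((S n : ℝ) / K n) (K n) t)).card : ℝ) - S n) / √(K n : ℝ) := by
    have : √(K n : ℝ) * (a - (S n : ℝ) / K n) = (K n * a - S n) / √(K n : ℝ) := by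
      rw [eq_div_iff hs.ne', mul_right_comm, hsq]
      have := (hKpos n).ne'
      field_simp
    rw [this, ← add_div, sub_add_sub_cancel]
  rw [hsum, le_div_iff₀ hs, zero_mul, sub_nonneg, Nat.cast_le]
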